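/- Let $X$ be a real reflexive Banach space with dual space $X^*$, and let $f : X \to X^*$ be a single-valued odd operator, i.e. $f(-x) = -f(x)$ for all $x \in X$ (no continuity is assumed). Let $G \subseteq X$ be a closed, balanced, convex neighborhood of $0$ such that $f(G)$ is a convex and (norm-)closed subset of $X^*$. Then there exist a subset $G_1 \subseteq G$ and a linear subspace $X_0^* \subseteq X^*$ such that 1. $X_0^*$ is the affine subspace of $X^*$ generated by $f(G)$ (which is thus a linear subspace); 2. $f(G_1) = \partial f(G)$, where $\partial f(G)$ is the boundary of $f(G)$ relative to $X_0^*$ with the topology induced by the norm of $X^*$; 3. for every $x^* \in X_0^*$ that satisfies $\|x^*\|_{X^*} \le \|f(x)\|_{X^*}$ for all $x \in G_1$, the equation $f(x) = x^*$ has a solution $x \in G$. -/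

import Mathlib

/-! Oddness gives `0 = f 0 ∈ C = f '' G`. If `y` in the span were outside `C`, the segment from `0`
to `y` would meet the relative frontier at some `t • y`, `t ≤ 1`; then `‖y‖ ≤ t * ‖y‖` forces `t =
1`, so `y ∈ C` as `C` is closed. -/

/-- The affine span of a set containing `0` is its linear span. -/
theorem coe_span_eq_coe_affineSpan {E : Type*} [AddCommGroup E] [Module ℝ E] {C : Set E}
    (h0 : (0 : E) ∈ C) : (Submodule.span ℝ C : Set E) = (affineSpan ℝ C : Set E) := by
  rw [← affineSpan_insert_zero, Set.insert_eq_of_mem h0]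

/-- A segment from a point of `C` to a point of the affine span of `C` outside `C` meets the
relative boundary of `C`. -/
theorem exists_lineMap_mem_intrinsicFrontier {E : Type*} [NormedAddCommGroup E] [NormedSpace ℝ E]
    {C : Set E} {x y : E} (hx : x ∈ C) (hy : y ∈ affineSpan ℝ C) (hyC : y ∉ C) :
    ∃ t ∈ Set.Icc (0 : ℝ) 1, AffineMap.lineMap x y t ∈ intrinsicFrontier ℝ C := by
  have hmem (t : ℝ) : AffineMap.lineMap x y t ∈ affineSpan ℝ C :=
    AffineMap.lineMap_mem t (subset_affineSpan ℝ C hx) hy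
  let γ : ℝ → affineSpan ℝ C := fun t ↦ ⟨AffineMap.lineMap x y t, hmem t⟩
  have hγ : Continuous γ := AffineMap.lineMap_continuous.subtype_mk hmem
  set S : Set (affineSpan ℝ C) := Subtype.val ⁻¹' C
  have h0 : γ 0 ∈ S := by simpa [γ, S] using hx
  have h1 : γ 1 ∉ S := by simpa [γ, S] using hyC
  obtain ⟨_, ⟨t, ht, rfl⟩, htf⟩ : (γ '' Set.Icc 0 1 ∩ frontier S).Nonempty := by
    by_contra hempty
    have hdisj : ∀ p ∈ γ '' Set.Icc 0 1, p ∉ frontier S := fun p hp hpf ↦ hempty ⟨p, hp, hpf⟩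
    have hγ0 : γ 0 ∈ γ '' Set.Icc 0 1 := ⟨0, by simp, rfl⟩
    have hγ1 : γ 1 ∈ γ '' Set.Icc 0 1 := ⟨1, by simp, rfl⟩
    -- Missing the frontier, the segment would be split by these two disjoint open sets.
    obtain ⟨p, -, hpi, hpc⟩ := isPreconnected_Icc.image γ hγ.continuousOn
      (interior S) (closure S)ᶜ isOpen_interior isClosed_closure.isOpen_compl
      (fun p hp ↦ or_iff_not_imp_left.2 fun hpi hpc ↦ hdisj p hp ⟨hpc, hpi⟩)
      ⟨γ 0, hγ0, by_contra fun h ↦ hdisj _ hγ0 ⟨subset_closure h0, h⟩⟩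
      ⟨γ 1, hγ1, fun h ↦ hdisj _ hγ1 ⟨h, fun h' ↦ h1 (interior_subset h')⟩⟩
    exact hpc (subset_closure (interior_subset hpi))
  exact ⟨t, ht, γ t, htf, rfl⟩

/-- A point of the affine span of a closed set `C` containing `0` belongs to `C` as soon as its norm
is at most that of every point of the relative boundary of `C`. -/
theorem mem_of_norm_le_intrinsicFrontier {E : Type*} [NormedAddCommGroup E] [NormedSpace ℝ E]
    {C : Set E} (hC : IsClosed C) (h0 : (0 : E) ∈ C) {y : E} (hy : y ∈ affineSpan ℝ C)
    (hle : ∀ z ∈ intrinsicFrontier ℝ C, ‖y‖ ≤ ‖z‖) : y ∈ C := by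
  by_contra hyC
  obtain ⟨t, ⟨ht0, ht1⟩, htf⟩ := exists_lineMap_mem_intrinsicFrontier h0 hy hyC
  have hy0 : 0 < ‖y‖ := norm_pos_iff.2 fun h ↦ hyC (h ▸ h0)
  have hnorm := hle _ htf
  rw [AffineMap.lineMap_apply_module, smul_zero, zero_add, norm_smul, Real.norm_of_nonneg ht0]
    at hnorm
  have ht : t = 1 := le_antisymm ht1 (by nlinarith)
  rw [ht, AffineMap.lineMap_apply_one] at htf
  exact hyC (intrinsicFrontier_subset hC htf)

theorem theorem14 {X : Type*} [NormedAddCommGroup X] [NormedSpace ℝ X] [CompleteSpace X]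
    (hX : Function.Surjective (NormedSpace.inclusionInDoubleDual ℝ X))
    (f : X → StrongDual ℝ X) (hf : Function.Odd f)
    (G : Set X) (hG_closed : IsClosed G) (hG_balanced : Balanced ℝ G) (hG_convex : Convex ℝ G)
    (hG_nhds : G ∈ nhds (0 : X))
    (hfG_convex : Convex ℝ (f '' G)) (hfG_closed : IsClosed (f '' G)) :
    ∃ (G₁ : Set X) (X₀ : Submodule ℝ (StrongDual ℝ X)),
      G₁ ⊆ G ∧
      (X₀ : Set (StrongDual ℝ X)) = (affineSpan ℝ (f '' G) : Set (StrongDual ℝ X)) ∧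
      f '' G₁ = intrinsicFrontier ℝ (f '' G) ∧
      ∀ y ∈ X₀, (∀ x ∈ G₁, ‖y‖ ≤ ‖f x‖) → ∃ x ∈ G, f x = y := by
  have hf0 : f 0 = 0 := by
    ext v
    have h := congrArg (fun φ : StrongDual ℝ X ↦ φ v) (hf 0)
    simp only [neg_zero, neg_apply] at h
    exact self_eq_neg.1 h
  have h0 : (0 : StrongDual ℝ X) ∈ f '' G := ⟨0, mem_of_mem_nhds hG_nhds, hf0⟩
  have hspan := coe_span_eq_coe_affineSpan h0
  -- Closedness keeps the frontier inside `f '' G`, so all of it is attained on `G`.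
  have himage : f '' (G ∩ f ⁻¹' intrinsicFrontier ℝ (f '' G)) = intrinsicFrontier ℝ (f '' G) := by
    rw [Set.image_inter_preimage]
    exact Set.inter_eq_right.2 (intrinsicFrontier_subset hfG_closed)
  refine ⟨G ∩ f ⁻¹' intrinsicFrontier ℝ (f '' G), Submodule.span ℝ (f '' G),
    Set.inter_subset_left, hspan, himage, fun y hy hle ↦ ?_⟩
  refine mem_of_norm_le_intrinsicFrontier hfG_closed h0 (hspan.subset hy) fun z hz ↦ ?_
  rw [← himage] at hz
  obtain ⟨x, hx, rfl⟩ := hz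
  exact hle x hx
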